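/- **Theorem 2.3.** For each integer $n\ge 1$ let $P_n(z)=a_nz^n+\cdots$ be a polynomial with integer coefficients, of exact degree $n$, all of whose complex zeros $\alpha_{1,n},\dots,\alpha_{n,n}$ are simple and lie in the closed unit disk $\{z\in\mathbb C:|z|\le 1\}$. Suppose that $$\lim_{n\to\infty}|a_n|^{1/n}=1.$$ Then the zero counting measures $\tau_n:=\frac1n\sum_{k=1}^n\delta_{\alpha_{k,n}}$ converge weak* to the normalized arclength measure $\mu_D$ on the unit circle, $d\mu_D(e^{it})=\frac1{2\pi}\,dt$; that is, $\int f\,d\tau_n\to\frac1{2\pi}\int_0^{2\pi}f(e^{it})\,dt$ for every bounded continuous function $f:\mathbb C\to\mathbb R$. Moreover, the arithmetic means $A_n:=\frac1n\sum_{k=1}^n\alpha_{k,n}$ of the zeros satisfy $\lim_{n\to\infty}A_n=0$. -/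

import Mathlib

open MeasureTheory Polynomial Filter Topology

/-- The set of polynomials with integer coefficients, of exact degree `n`, all of whose complex
zeros are simple and lie in `E`. (`P.aroots ℂ` is the multiset of complex zeros of `P`, listed
with multiplicity.) -/
def IntPolySimple (n : ℕ) (E : Set ℂ) : Set ℤ[X] :=
  {P | P.degree = n ∧ (P.aroots ℂ).Nodup ∧ ∀ z ∈ P.aroots ℂ, z ∈ E}

/-- The zero counting measure `(1/n) ∑ δ_α` of a polynomial of degree `n`, the sum being over its
complex zeros `α` with multiplicity. -/
noncomputable def zeroCountingMeasure (P : ℤ[X]) : Measure ℂ :=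
  (P.natDegree : NNReal)⁻¹ • ((P.aroots ℂ).map (fun α => Measure.dirac α)).sum

/-- The normalized arclength measure on the unit circle, as a measure on `ℂ`: the image of
`dt / (2π)` on `(0, 2π]` under `t ↦ e^{it}`. -/
noncomputable def normalizedArclength : Measure ℂ :=
  Measure.map (fun t : ℝ => Complex.exp (t * Complex.I))
    ((2 * NNReal.pi)⁻¹ • volume.restrict (Set.Ioc 0 (2 * Real.pi)))

/-- The arithmetic mean of the complex zeros (with multiplicity) of a polynomial. -/
noncomputable def meanOfZeros (P : ℤ[X]) : ℂ :=
  (P.aroots ℂ).sum / P.natDegree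

instance isFiniteMeasure_zeroCountingMeasure (P : ℤ[X]) :
    IsFiniteMeasure (zeroCountingMeasure P) := by
  have h : ∀ s : Multiset ℂ,
      IsFiniteMeasure (s.map (fun α => (Measure.dirac α : Measure ℂ))).sum := by
    intro s
    induction s using Multiset.induction_on with
    | empty => simp only [Multiset.map_zero, Multiset.sum_zero]; infer_instance
    | cons a s ih => simp only [Multiset.map_cons, Multiset.sum_cons]; infer_instance
  have := h (P.aroots ℂ)
  unfold zeroCountingMeasure
  infer_instance

instance isFiniteMeasure_normalizedArclength : IsFiniteMeasure normalizedArclength := by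
  unfold normalizedArclength
  infer_instance

/-! The argument compares two bounds for the energy `∑ log ‖x - y‖` over ordered pairs of distinct
zeros. Simple zeros make the resultant of `P` and `P'` a nonzero integer, so the energy is at least
`-(2n-1) log |aₙ| = -o(n²)`. Conversely, on the disk `log ‖z - w‖` is at most `log ‖1 - ρ z w̄‖`
plus an error that vanishes as `ρ → 1`, minus a gain `(1 - ‖z‖²)(1 - ‖w‖²)/8`. Expanding the
logarithm turns the double sum into `-∑ ρᵏ ‖∑ zᵏ‖² / k`, so the energy is at most `o(n²)` minus
squares of power sums and of the defect `∑ (1 - ‖z‖²)` (`sum_log_norm_sub_add_le`). Hence every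
normalized moment and the mean defect tend to 0. A small defect replaces `z̄ z` by 1 on average, so
all mixed moments converge to those of the circle, and Stone–Weierstrass finishes. The mean is the
first moment. -/

/-! ### Arithmetic lower bound from the discriminant. -/

theorem one_le_leadingCoeff_pow_mul_prod_dist {P : ℤ[X]} (hdeg : 0 < P.natDegree)
    (hnd : (P.aroots ℂ).Nodup) :
    1 ≤ |(P.leadingCoeff : ℝ)| ^ (2 * P.natDegree - 1) *
      ∏ x ∈ (P.aroots ℂ).toFinset, ∏ y ∈ (P.aroots ℂ).toFinset.erase x, ‖x - y‖ := by
  set f : ℂ[X] := P.map (algebraMap ℤ ℂ) with hf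
  have hinj : Function.Injective (algebraMap ℤ ℂ) := (algebraMap ℤ ℂ).injective_int
  have hsplit : f.Splits := IsAlgClosed.splits f
  have hfd : f.natDegree = P.natDegree := natDegree_map_eq_of_injective hinj P
  have hroots : P.aroots ℂ = f.roots := rfl
  have hlc : f.leadingCoeff = (P.leadingCoeff : ℂ) := by
    rw [hf, leadingCoeff_map_of_injective hinj]; simp
  rw [hroots] at hnd ⊢
  set S := f.roots.toFinset with hS
  have hSv : S.val = f.roots := by rw [hS, Multiset.toFinset_val, hnd.dedup]
  have hcard : S.card = P.natDegree := by
    rw [Finset.card_def, hSv, ← hsplit.natDegree_eq_card_roots, hfd]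
  have hfac : f = C (P.leadingCoeff : ℂ) * ∏ x ∈ S, (X - C x) := by
    conv_lhs => rw [hsplit.eq_prod_roots, hlc]
    rw [Finset.prod, hSv]
  have hlc0 : (P.leadingCoeff : ℂ) ≠ 0 := by
    have : P ≠ 0 := by rintro rfl; simp at hdeg
    simpa using this
  have hder : ∀ x ∈ S, f.derivative.eval x =
      (P.leadingCoeff : ℂ) * ∏ y ∈ S.erase x, (x - y) := by
    intro x hx
    rw [hfac, ← Finset.mul_prod_erase S _ hx]
    simp [derivative_mul, eval_prod]
  have hres : ((resultant P P.derivative P.natDegree (P.natDegree - 1) : ℤ) : ℂ) =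
      (P.leadingCoeff : ℂ) ^ (2 * P.natDegree - 1) * ∏ x ∈ S, ∏ y ∈ S.erase x, (x - y) := by
    have h1 := resultant_eq_prod_eval f f.derivative (P.natDegree - 1)
      (hfd ▸ natDegree_derivative_le f) hsplit
    have h2 := resultant_map_map P P.derivative P.natDegree (P.natDegree - 1) (algebraMap ℤ ℂ)
    rw [← derivative_map, ← hf] at h2
    rw [hfd, h2, hlc, ← hSv] at h1
    have h3 : (S.val.map fun x => f.derivative.eval x).prod =
        ∏ x ∈ S, f.derivative.eval x := rfl
    -- The resultant carries `n - 1` leading coefficients, and each of the `n` values of `P'` at a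
    -- zero adds one.
    rw [h3, Finset.prod_congr rfl hder, Finset.prod_mul_distrib, Finset.prod_const, hcard,
      ← mul_assoc, ← pow_add, show P.natDegree - 1 + P.natDegree = 2 * P.natDegree - 1 by omega]
      at h1
    simpa using h1
  have hne : resultant P P.derivative P.natDegree (P.natDegree - 1) ≠ 0 := by
    intro h0
    rw [h0, Int.cast_zero, eq_comm] at hres
    refine mul_ne_zero (pow_ne_zero _ hlc0) ?_ hres
    refine Finset.prod_ne_zero_iff.2 fun x _ => Finset.prod_ne_zero_iff.2 fun y hy => ?_
    exact sub_ne_zero.2 (Finset.ne_of_mem_erase hy).symm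
  have h4 := congrArg norm hres
  simp only [norm_mul, norm_pow, norm_prod, Complex.norm_intCast] at h4
  rw [← h4]
  exact_mod_cast Int.one_le_abs hne

/-! ### Upper bound for the energy in the disk. -/

theorem norm_one_sub_le_of_norm_le_one {u : ℂ} (hu : ‖u‖ ≤ 1) {ρ : ℝ} (h0 : 0 < ρ) (h1 : ρ < 1) :
    ‖1 - u‖ ≤ 2 / (1 + ρ) * ‖1 - ρ * u‖ := by
  have hre : -1 ≤ u.re := by
    have := Complex.abs_re_le_norm u; rw [abs_le] at this; linarith
  have hn : u.re ^ 2 + u.im ^ 2 ≤ 1 := by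
    have := Complex.sq_norm u; rw [Complex.normSq_apply] at this; nlinarith [norm_nonneg u]
  rw [div_mul_eq_mul_div, le_div_iff₀ (by linarith)]
  refine le_of_sq_le_sq ?_ (by positivity)
  rw [mul_pow, mul_pow, Complex.sq_norm, Complex.sq_norm, Complex.normSq_apply,
    Complex.normSq_apply]
  simp
  -- The difference of the two sides is `(1-ρ)(1+3ρ)(1-‖u‖²) + 2(1-ρ)²(1 + Re u)`.
  nlinarith [mul_nonneg (mul_nonneg (sub_nonneg.2 h1.le) (by linarith : 0 ≤ 3 * ρ + 1)) (by linarith : 0 ≤ 1 - u.re ^ 2 - u.im ^ 2), mul_nonneg (mul_nonneg (sub_nonneg.2 h1.le) (sub_nonneg.2 h1.le)) (by linarith : 0 ≤ 1 + u.re), mul_nonneg (sub_nonneg.2 h1.le) (by linarith : 0 ≤ 1 + u.re)]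

theorem norm_sub_sq_eq (z w : ℂ) :
    ‖z - w‖ ^ 2 = ‖1 - z * (starRingEnd ℂ) w‖ ^ 2 - (1 - ‖z‖ ^ 2) * (1 - ‖w‖ ^ 2) := by
  simp only [Complex.sq_norm, Complex.normSq_apply]
  simp
  ring

theorem log_norm_sub_le {z w : ℂ} (hz : ‖z‖ ≤ 1) (hw : ‖w‖ ≤ 1) (hzw : z ≠ w) {ρ : ℝ}
    (h0 : 0 < ρ) (h1 : ρ < 1) :
    Real.log ‖z - w‖ ≤ Real.log (2 / (1 + ρ)) + Real.log ‖1 - ρ * (z * (starRingEnd ℂ) w)‖ -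
      (1 - ‖z‖ ^ 2) * (1 - ‖w‖ ^ 2) / 8 := by
  have hpos : 0 < ‖z - w‖ := norm_pos_iff.2 (sub_ne_zero.2 hzw)
  have hid := norm_sub_sq_eq z w
  set A := ‖1 - z * (starRingEnd ℂ) w‖ with hA
  have hq : 0 ≤ (1 - ‖z‖ ^ 2) * (1 - ‖w‖ ^ 2) :=
    mul_nonneg (by nlinarith [norm_nonneg z]) (by nlinarith [norm_nonneg w])
  set q := (1 - ‖z‖ ^ 2) * (1 - ‖w‖ ^ 2) with hqdef
  have hu : ‖z * (starRingEnd ℂ) w‖ ≤ 1 := by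
    rw [norm_mul, Complex.norm_conj]; exact mul_le_one₀ hz (norm_nonneg w) hw
  have hA2 : A ≤ 2 := by
    calc A ≤ ‖(1 : ℂ)‖ + ‖z * (starRingEnd ℂ) w‖ := norm_sub_le _ _
      _ ≤ 2 := by rw [norm_one]; linarith
  have hA0 : 0 < A := by
    have : 0 < A ^ 2 := by nlinarith [pow_pos hpos 2]
    exact lt_of_le_of_ne (norm_nonneg _) fun h => by rw [← h] at this; norm_num at this
  have hB := norm_one_sub_le_of_norm_le_one hu h0 h1
  rw [← hA] at hB
  have hr : 0 < 2 / (1 + ρ) := by positivity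
  have hB0 : 0 < ‖1 - ρ * (z * (starRingEnd ℂ) w)‖ := by
    by_contra h
    have : ‖1 - ρ * (z * (starRingEnd ℂ) w)‖ = 0 := le_antisymm (not_lt.1 h) (norm_nonneg _)
    rw [this, mul_zero] at hB; linarith
  have hlA := Real.log_le_log hA0 hB
  rw [Real.log_mul hr.ne' hB0.ne'] at hlA
  -- The ratio is `1 - q / A²` with `A ≤ 2`; halving the logarithm of the square gives `q / 8`.
  have hlog : Real.log (‖z - w‖ ^ 2 / A ^ 2) ≤ ‖z - w‖ ^ 2 / A ^ 2 - 1 :=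
    Real.log_le_sub_one_of_pos (by positivity)
  rw [Real.log_div (by positivity) (by positivity), Real.log_pow, Real.log_pow, hid, sub_div,
    div_self (by positivity)] at hlog
  have : q / 4 ≤ q / A ^ 2 := div_le_div_of_nonneg_left hq (by positivity) (by nlinarith)
  push_cast at hlog
  linarith

/-- The kernel `-log ‖1 - ρ z w̄‖` is positive definite: its Taylor series sums to nonnegative
terms, of which only the `m`-th is kept. For `m = 0` that term is 0, since division by zero gives 0.
-/
theorem sum_log_norm_one_sub_le (S : Finset ℂ) (hS : ∀ z ∈ S, ‖z‖ ≤ 1) {ρ : ℝ} (h0 : 0 < ρ)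
    (h1 : ρ < 1) (m : ℕ) :
    ∑ z ∈ S, ∑ w ∈ S, Real.log ‖1 - ρ * (z * (starRingEnd ℂ) w)‖ ≤
      -(ρ ^ m * ‖∑ z ∈ S, z ^ m‖ ^ 2 / m) := by
  have key : HasSum (fun k : ℕ => ρ ^ k * ‖∑ z ∈ S, z ^ k‖ ^ 2 / k)
      (-∑ z ∈ S, ∑ w ∈ S, Real.log ‖1 - ρ * (z * (starRingEnd ℂ) w)‖) := by
    have h : ∀ z ∈ S, ∀ w ∈ S, HasSum (fun k : ℕ => ((ρ * (z * (starRingEnd ℂ) w)) ^ k / k).re)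
        (-Real.log ‖1 - ρ * (z * (starRingEnd ℂ) w)‖) := by
      intro z hz w hw
      have hu : ‖ρ * (z * (starRingEnd ℂ) w)‖ < 1 := by
        rw [norm_mul, norm_mul, Complex.norm_conj, Complex.norm_real, Real.norm_of_nonneg h0.le]
        have := mul_le_one₀ (hS z hz) (norm_nonneg w) (hS w hw)
        nlinarith
      have := Complex.hasSum_re (Complex.hasSum_taylorSeries_neg_log hu)
      rwa [Complex.neg_re, Complex.log_re] at this
    have h2 := hasSum_sum fun z hz => hasSum_sum (h z hz)
    simp only [Finset.sum_neg_distrib] at h2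
    convert! h2 using 2 with k
    simp only [← Complex.re_sum]
    rw [← Complex.ofReal_re (ρ ^ k * ‖∑ z ∈ S, z ^ k‖ ^ 2 / k)]
    congr 1
    push_cast
    rw [← Complex.mul_conj', map_sum, Finset.sum_mul_sum, Finset.mul_sum, Finset.sum_div]
    refine Finset.sum_congr rfl fun z _ => ?_
    rw [Finset.mul_sum, Finset.sum_div]
    refine Finset.sum_congr rfl fun w _ => ?_
    rw [map_pow]; ring
  have := le_hasSum key m fun k _ => by positivity
  linarith

theorem sum_log_norm_sub_add_le (S : Finset ℂ) (hS : ∀ z ∈ S, ‖z‖ ≤ 1) {ρ : ℝ} (h0 : 0 < ρ)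
    (h1 : ρ < 1) (m : ℕ) :
    ∑ x ∈ S, ∑ y ∈ S.erase x, Real.log ‖x - y‖ + ρ ^ m * ‖∑ z ∈ S, z ^ m‖ ^ 2 / m +
        (∑ z ∈ S, (1 - ‖z‖ ^ 2)) ^ 2 / 8 ≤
      (S.card : ℝ) ^ 2 * Real.log (2 / (1 + ρ)) + S.card * (1 / 8 - Real.log (1 - ρ)) := by
  have hL : 0 ≤ Real.log (2 / (1 + ρ)) :=
    Real.log_nonneg (by rw [le_div_iff₀ (by linarith)]; linarith)
  have key : ∀ x ∈ S, ∑ y ∈ S.erase x, Real.log ‖x - y‖ ≤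
      S.card * Real.log (2 / (1 + ρ)) + ∑ y ∈ S, Real.log ‖1 - ρ * (x * (starRingEnd ℂ) y)‖ -
        (∑ y ∈ S, (1 - ‖x‖ ^ 2) * (1 - ‖y‖ ^ 2)) / 8 + (1 / 8 - Real.log (1 - ρ)) := by
    intro x hx
    have hx1 := hS x hx
    have hq0 : 0 ≤ 1 - ‖x‖ ^ 2 := by nlinarith [norm_nonneg x]
    have hq1 : 1 - ‖x‖ ^ 2 ≤ 1 := by nlinarith [norm_nonneg x]
    -- Adding the diagonal back costs at most `1/8 - log (1 - ρ)` per point, which is only linear in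
    -- the cardinality.
    have hdiag : Real.log (1 - ρ) ≤ Real.log ‖1 - ρ * (x * (starRingEnd ℂ) x)‖ := by
      refine Real.log_le_log (by linarith) ?_
      have := norm_sub_norm_le (1 : ℂ) (ρ * (x * (starRingEnd ℂ) x))
      rw [norm_one, norm_mul, norm_mul, Complex.norm_conj, Complex.norm_real,
        Real.norm_of_nonneg h0.le] at this
      nlinarith [norm_nonneg x]
    have hoff : ∑ y ∈ S.erase x, Real.log ‖x - y‖ ≤ ∑ y ∈ S.erase x,
        (Real.log (2 / (1 + ρ)) + Real.log ‖1 - ρ * (x * (starRingEnd ℂ) y)‖ -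
          (1 - ‖x‖ ^ 2) * (1 - ‖y‖ ^ 2) / 8) := by
      refine Finset.sum_le_sum fun y hy => ?_
      exact log_norm_sub_le hx1 (hS y (Finset.mem_of_mem_erase hy))
        (Finset.ne_of_mem_erase hy).symm h0 h1
    have hadd := Finset.sum_erase_add S (fun y =>
        (Real.log (2 / (1 + ρ)) + Real.log ‖1 - ρ * (x * (starRingEnd ℂ) y)‖ -
          (1 - ‖x‖ ^ 2) * (1 - ‖y‖ ^ 2) / 8)) hx
    have hsq : (1 - ‖x‖ ^ 2) * (1 - ‖x‖ ^ 2) ≤ 1 := mul_le_one₀ hq1 hq0 hq1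
    simp only [Finset.sum_sub_distrib, Finset.sum_add_distrib, Finset.sum_const, nsmul_eq_mul,
      ← Finset.sum_div] at hadd hoff
    linarith
  have h2 := Finset.sum_le_sum key
  rw [Finset.sum_add_distrib, Finset.sum_sub_distrib, Finset.sum_add_distrib, Finset.sum_const,
    Finset.sum_const, ← Finset.sum_div, ← Finset.sum_mul_sum, nsmul_eq_mul, nsmul_eq_mul] at h2
  have h3 := sum_log_norm_one_sub_le S hS h0 h1 m
  linarith

/-- If the logarithmic energies of normalized counting measures on finite subsets of the closed
unit disk are asymptotically nonpositive, then the power moments and the mean defect of the squared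
moduli tend to zero. -/
theorem tendsto_moment_add_defect {S : ℕ → Finset ℂ} (hS : ∀ n, 1 ≤ n → ∀ z ∈ S n, ‖z‖ ≤ 1)
    (hcard : ∀ n, 1 ≤ n → (S n).card = n) {c : ℕ → ℝ} (hc : Tendsto c atTop (𝓝 0))
    (hE : ∀ n : ℕ, 1 ≤ n →
      -((n : ℝ) ^ 2 * c n) ≤ ∑ x ∈ S n, ∑ y ∈ (S n).erase x, Real.log ‖x - y‖) (m : ℕ) :
    Tendsto (fun n : ℕ => ‖(∑ z ∈ S n, z ^ m) / n‖ ^ 2 / m +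
      ((∑ z ∈ S n, (1 - ‖z‖ ^ 2)) / n) ^ 2 / 8) atTop (𝓝 0) := by
  refine tendsto_order.2 ⟨fun a ha => Eventually.of_forall fun n => lt_of_lt_of_le ha
    (by positivity), fun ε hε => ?_⟩
  -- Fix `ρ` near 1 before letting `n → ∞`, so that the diagonal cost divided by `n²` vanishes.
  have hρ : ∃ ρ : ℝ, 0 < ρ ∧ ρ < 1 ∧ Real.log (2 / (1 + ρ)) / ρ ^ m < ε := by
    have hcont : ContinuousAt (fun ρ : ℝ => Real.log (2 / (1 + ρ)) / ρ ^ m) 1 := by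
      refine ContinuousAt.div (ContinuousAt.log (ContinuousAt.div ?_ ?_ ?_) ?_) ?_ ?_ <;>
        first | fun_prop | norm_num
    have h1 : ∀ᶠ ρ in 𝓝 (1 : ℝ), Real.log (2 / (1 + ρ)) / ρ ^ m < ε :=
      hcont.eventually_lt_const (by norm_num; exact hε)
    have h2 : ∀ᶠ ρ in 𝓝[<] (1 : ℝ), 0 < ρ ∧ ρ < 1 := by
      filter_upwards [Ioo_mem_nhdsLT (zero_lt_one' ℝ)] with ρ h using h
    obtain ⟨ρ, h3, h4⟩ := ((h1.filter_mono nhdsWithin_le_nhds).and h2).exists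
    exact ⟨ρ, h4.1, h4.2, h3⟩
  obtain ⟨ρ, h0, h1, hlt⟩ := hρ
  have hpow : 0 < ρ ^ m := pow_pos h0 m
  have hpow1 : ρ ^ m ≤ 1 := pow_le_one₀ h0.le h1.le
  have hlim : Tendsto (fun n : ℕ => (Real.log (2 / (1 + ρ)) + c n +
      (1 / 8 - Real.log (1 - ρ)) / n) / ρ ^ m) atTop (𝓝 (Real.log (2 / (1 + ρ)) / ρ ^ m)) := by
    simpa using ((hc.const_add (Real.log (2 / (1 + ρ)))).add
      (tendsto_const_div_atTop_nhds_zero_nat (1 / 8 - Real.log (1 - ρ)))).div_const (ρ ^ m)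
  filter_upwards [hlim.eventually_lt_const hlt, eventually_ge_atTop 1] with n hn hn1
  refine lt_of_le_of_lt ?_ hn
  rw [le_div_iff₀ hpow]
  have hnpos : (0 : ℝ) < n := by exact_mod_cast hn1
  have h2 := sum_log_norm_sub_add_le (S n) (hS n hn1) h0 h1 m
  have h3 := hE n hn1
  rw [hcard n hn1] at h2
  set p := ‖∑ z ∈ S n, z ^ m‖
  set d := ∑ z ∈ S n, (1 - ‖z‖ ^ 2)
  rw [norm_div, Complex.norm_natCast]
  have h4 : ρ ^ m * p ^ 2 / m + d ^ 2 / 8 ≤ (n : ℝ) ^ 2 * (Real.log (2 / (1 + ρ)) + c n) +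
      n * (1 / 8 - Real.log (1 - ρ)) := by linarith
  have h5 : (p / n) ^ 2 / m + (d / n) ^ 2 / 8 = (p ^ 2 / m + d ^ 2 / 8) / (n : ℝ) ^ 2 := by
    ring
  have h6 : Real.log (2 / (1 + ρ)) + c n + (1 / 8 - Real.log (1 - ρ)) / n =
      ((n : ℝ) ^ 2 * (Real.log (2 / (1 + ρ)) + c n) + n * (1 / 8 - Real.log (1 - ρ))) /
        (n : ℝ) ^ 2 := by
    field_simp
  rw [h5, h6, div_mul_eq_mul_div]
  refine div_le_div_of_nonneg_right (le_trans ?_ h4) (by positivity)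
  have h7 : d ^ 2 / 8 * ρ ^ m ≤ d ^ 2 / 8 := mul_le_of_le_one_right (by positivity) hpow1
  have h8 : p ^ 2 / m * ρ ^ m = ρ ^ m * p ^ 2 / m := by ring
  linarith

theorem tendsto_zero_of_sq_le_mul {u v : ℕ → ℝ} (C : ℝ) (hv : Tendsto v atTop (𝓝 0))
    (h : ∀ n, u n ^ 2 ≤ C * v n) : Tendsto u atTop (𝓝 0) := by
  have h1 : Tendsto (fun n => u n ^ 2) atTop (𝓝 0) :=
    squeeze_zero (fun n => sq_nonneg _) h (by simpa using hv.const_mul C)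
  have h2 := h1.sqrt
  simp only [Real.sqrt_sq_eq_abs, Real.sqrt_zero] at h2
  exact (tendsto_zero_iff_abs_tendsto_zero _).2 h2

/-! ### From moments to continuous test functions. -/

/-- The difference is `-zᵏ (1 - ‖z‖^(2b))`; Bernoulli's inequality bounds it by the defect. -/
theorem norm_pow_mul_conj_pow_sub_le {z : ℂ} (hz : ‖z‖ ≤ 1) (k b : ℕ) :
    ‖z ^ (k + b) * (starRingEnd ℂ) z ^ b - z ^ k‖ ≤ b * (1 - ‖z‖ ^ 2) := by
  have h1 : z ^ (k + b) * (starRingEnd ℂ) z ^ b - z ^ k =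
      -(z ^ k * ((1 - (‖z‖ ^ 2) ^ b : ℝ) : ℂ)) := by
    push_cast
    rw [← Complex.mul_conj', pow_add, mul_pow]; ring
  have hr0 : 0 ≤ ‖z‖ ^ 2 := by positivity
  have hr1 : ‖z‖ ^ 2 ≤ 1 := pow_le_one₀ (norm_nonneg _) hz
  have h2 := one_add_mul_le_pow (a := ‖z‖ ^ 2 - 1) (by linarith) b
  have h3 : (‖z‖ ^ 2) ^ b ≤ 1 := pow_le_one₀ hr0 hr1
  rw [h1, norm_neg, norm_mul, norm_pow, Complex.norm_real, Real.norm_of_nonneg (by linarith)]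
  have h4 : ‖z‖ ^ k ≤ 1 := pow_le_one₀ (norm_nonneg _) hz
  rw [add_sub_cancel] at h2
  nlinarith [mul_le_of_le_one_left (sub_nonneg.2 h3) h4]

theorem circleAverage_pow_mul_conj_pow (a b : ℕ) :
    (2 * Real.pi : ℂ)⁻¹ * ∫ t in (0 : ℝ)..2 * Real.pi, Complex.exp (t * Complex.I) ^ a *
      (starRingEnd ℂ) (Complex.exp (t * Complex.I)) ^ b = if a = b then 1 else 0 := by
  have h : ∀ t : ℝ, Complex.exp (t * Complex.I) ^ a *
      (starRingEnd ℂ) (Complex.exp (t * Complex.I)) ^ b =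
      Complex.exp (((a : ℂ) - b) * Complex.I * t) := by
    intro t
    rw [← Complex.exp_conj, ← Complex.exp_nat_mul, ← Complex.exp_nat_mul, ← Complex.exp_add]
    congr 1
    simp
    ring
  simp only [h]
  split_ifs with hab
  · subst hab
    have : (Real.pi : ℂ) ≠ 0 := by exact_mod_cast Real.pi_ne_zero
    simp
    field_simp
  · have hne : ((a : ℂ) - b) * Complex.I ≠ 0 :=
      mul_ne_zero (sub_ne_zero.2 (by exact_mod_cast hab)) Complex.I_ne_zero
    rw [integral_exp_mul_complex hne]
    have : Complex.exp (((a : ℂ) - b) * Complex.I * ((2 * Real.pi : ℝ) : ℂ)) = 1 := by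
      rw [Complex.exp_eq_one_iff]
      exact ⟨(a : ℤ) - b, by push_cast; ring⟩
    rw [this]
    simp

/-- Stone–Weierstrass on the closed disk; the star closure of the polynomials supplies the variable
`z̄`. -/
theorem exists_mvPolynomial_near (f : ℂ → ℂ) (hf : Continuous f) {ε : ℝ} (hε : 0 < ε) :
    ∃ Q : MvPolynomial (Fin 2) ℂ, ∀ z : ℂ, ‖z‖ ≤ 1 →
      ‖f z - MvPolynomial.eval ![z, (starRingEnd ℂ) z] Q‖ < ε := by
  let D : Set ℂ := Metric.closedBall 0 1
  have : CompactSpace D := isCompact_iff_compactSpace.1 (isCompact_closedBall 0 1)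
  have h : ∀ g : C(D, ℂ), ∀ ε > 0, ∃ Q : MvPolynomial (Fin 2) ℂ, ∀ z : D,
      ‖g z - MvPolynomial.eval ![(z : ℂ), (starRingEnd ℂ) (z : ℂ)] Q‖ < ε := by
    intro g ε hε
    have hmem : g ∈ (polynomialFunctions D).starClosure.topologicalClosure := by
      rw [polynomialFunctions.starClosure_topologicalClosure]; trivial
    rw [← SetLike.mem_coe, StarSubalgebra.topologicalClosure_coe, Metric.mem_closure_iff] at hmem
    obtain ⟨g', hg', hd⟩ := hmem ε hε
    have hex : ∃ Q : MvPolynomial (Fin 2) ℂ, ∀ z : D,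
        g' z = MvPolynomial.eval ![(z : ℂ), (starRingEnd ℂ) (z : ℂ)] Q := by
      clear hd
      rw [polynomialFunctions.starClosure_eq_adjoin_X] at hg'
      induction hg' using Algebra.adjoin_induction with
      | mem f hf =>
        rw [Set.mem_union, Set.mem_star, Set.mem_singleton_iff, Set.mem_singleton_iff,
          star_eq_iff_star_eq, eq_comm (b := f)] at hf
        obtain rfl | rfl := hf
        · exact ⟨MvPolynomial.X 0, fun z => by simp⟩
        · exact ⟨MvPolynomial.X 1, fun z => by simp⟩
      | algebraMap r => exact ⟨MvPolynomial.C r, fun z => by simp⟩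
      | add f g _ _ hf hg =>
        obtain ⟨Q, hQ⟩ := hf
        obtain ⟨R, hR⟩ := hg
        exact ⟨Q + R, fun z => by simp [hQ, hR]⟩
      | mul f g _ _ hf hg =>
        obtain ⟨Q, hQ⟩ := hf
        obtain ⟨R, hR⟩ := hg
        exact ⟨Q * R, fun z => by simp [hQ, hR]⟩
    obtain ⟨Q, hQ⟩ := hex
    refine ⟨Q, fun z => ?_⟩
    rw [← hQ z, ← dist_eq_norm]
    exact lt_of_le_of_lt (ContinuousMap.dist_apply_le_dist z) hd
  obtain ⟨Q, hQ⟩ := h ⟨fun z => f z, by fun_prop⟩ ε hε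
  exact ⟨Q, fun z hz => hQ ⟨z, by simpa [D] using hz⟩⟩

theorem integral_zeroCountingMeasure {P : ℤ[X]} (hnd : (P.aroots ℂ).Nodup) (f : ℂ → ℂ) :
    ∫ z, f z ∂zeroCountingMeasure P = (∑ z ∈ (P.aroots ℂ).toFinset, f z) / P.natDegree := by
  have h : ((P.aroots ℂ).map (fun α => Measure.dirac α)).sum =
      ∑ z ∈ (P.aroots ℂ).toFinset, Measure.dirac z := by
    rw [Finset.sum, Multiset.toFinset_val, hnd.dedup]
  rw [zeroCountingMeasure, h, integral_smul_nnreal_measure, integral_finsetSum_measure]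
  · simp only [integral_dirac]
    rw [NNReal.smul_def, Complex.real_smul]
    push_cast
    rw [div_eq_inv_mul]
  · intro z _
    exact integrable_dirac (by simp)

theorem integral_normalizedArclength {f : ℂ → ℂ} (hf : Continuous f) :
    ∫ z, f z ∂normalizedArclength =
      (2 * Real.pi : ℂ)⁻¹ * ∫ t in (0 : ℝ)..2 * Real.pi, f (Complex.exp (t * Complex.I)) := by
  rw [normalizedArclength, integral_map (by fun_prop) (by fun_prop), integral_smul_nnreal_measure,
    intervalIntegral.integral_of_le (by positivity), NNReal.smul_def, Complex.real_smul]
  simp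

section Equidistribution

variable {S : ℕ → Finset ℂ}

theorem tendsto_average_pow_mul_conj_pow_aux (hS : ∀ n, 1 ≤ n → ∀ z ∈ S n, ‖z‖ ≤ 1)
    (hcard : ∀ n, 1 ≤ n → (S n).card = n)
    (hmom : ∀ m : ℕ, m ≠ 0 → Tendsto (fun n : ℕ => (∑ z ∈ S n, z ^ m) / n) atTop (𝓝 0))
    (hdef : Tendsto (fun n : ℕ => (∑ z ∈ S n, (1 - ‖z‖ ^ 2)) / (n : ℝ)) atTop (𝓝 0)) (k b : ℕ) :
    Tendsto (fun n : ℕ => (∑ z ∈ S n, z ^ (k + b) * (starRingEnd ℂ) z ^ b) / n) atTop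
      (𝓝 (if k = 0 then 1 else 0)) := by
  have h1 : Tendsto (fun n : ℕ => (∑ z ∈ S n, z ^ k) / n) atTop (𝓝 (if k = 0 then 1 else 0)) := by
    split_ifs with hk
    · subst hk
      refine tendsto_const_nhds.congr' ?_
      filter_upwards [eventually_ge_atTop 1] with n hn
      have : (n : ℂ) ≠ 0 := by exact_mod_cast (by omega : n ≠ 0)
      simp [hcard n hn, this]
    · exact hmom k hk
  have h2 : Tendsto (fun n : ℕ => (∑ z ∈ S n, (z ^ (k + b) * (starRingEnd ℂ) z ^ b - z ^ k)) / n)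
      atTop (𝓝 0) := by
    refine squeeze_zero_norm' ?_ (by rw [← mul_zero (b : ℝ)]; exact hdef.const_mul (b : ℝ))
    filter_upwards [eventually_ge_atTop 1] with n hn
    rw [norm_div, Complex.norm_natCast, ← mul_div_assoc, Finset.mul_sum]
    gcongr
    exact norm_sum_le_of_le _ fun z hz => norm_pow_mul_conj_pow_sub_le (hS n hn z hz) k b
  have h3 := h1.add h2
  rw [add_zero] at h3
  refine h3.congr ?_
  intro n
  rw [← add_div, ← Finset.sum_add_distrib]
  simp only [add_sub_cancel]

theorem tendsto_average_pow_mul_conj_pow (hS : ∀ n, 1 ≤ n → ∀ z ∈ S n, ‖z‖ ≤ 1)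
    (hcard : ∀ n, 1 ≤ n → (S n).card = n)
    (hmom : ∀ m : ℕ, m ≠ 0 → Tendsto (fun n : ℕ => (∑ z ∈ S n, z ^ m) / n) atTop (𝓝 0))
    (hdef : Tendsto (fun n : ℕ => (∑ z ∈ S n, (1 - ‖z‖ ^ 2)) / (n : ℝ)) atTop (𝓝 0)) (a b : ℕ) :
    Tendsto (fun n : ℕ => (∑ z ∈ S n, z ^ a * (starRingEnd ℂ) z ^ b) / n) atTop
      (𝓝 (if a = b then 1 else 0)) := by
  rcases le_total b a with hab | hab
  · obtain ⟨k, rfl⟩ := Nat.exists_eq_add_of_le' hab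
    simpa using tendsto_average_pow_mul_conj_pow_aux hS hcard hmom hdef k b
  · obtain ⟨k, rfl⟩ := Nat.exists_eq_add_of_le' hab
    have h := (Complex.continuous_conj.tendsto _).comp
      (tendsto_average_pow_mul_conj_pow_aux hS hcard hmom hdef k a)
    have hlim : (starRingEnd ℂ) (if k = 0 then 1 else 0) = if a = k + a then 1 else 0 := by
      rcases eq_or_ne k 0 with rfl | hk
      · simp
      · simp [hk]
    rw [hlim] at h
    refine h.congr fun n => ?_
    simp only [Function.comp_apply, map_div₀, map_sum, map_mul, map_pow, Complex.conj_conj,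
      Complex.conj_natCast]
    simp only [mul_comm]

theorem tendsto_average_mvPolynomial (hS : ∀ n, 1 ≤ n → ∀ z ∈ S n, ‖z‖ ≤ 1)
    (hcard : ∀ n, 1 ≤ n → (S n).card = n)
    (hmom : ∀ m : ℕ, m ≠ 0 → Tendsto (fun n : ℕ => (∑ z ∈ S n, z ^ m) / n) atTop (𝓝 0))
    (hdef : Tendsto (fun n : ℕ => (∑ z ∈ S n, (1 - ‖z‖ ^ 2)) / (n : ℝ)) atTop (𝓝 0))
    (Q : MvPolynomial (Fin 2) ℂ) :
    Tendsto (fun n : ℕ => (∑ z ∈ S n, MvPolynomial.eval ![z, (starRingEnd ℂ) z] Q) / n) atTop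
      (𝓝 ((2 * Real.pi : ℂ)⁻¹ * ∫ t in (0 : ℝ)..2 * Real.pi,
        MvPolynomial.eval ![Complex.exp (t * Complex.I),
          (starRingEnd ℂ) (Complex.exp (t * Complex.I))] Q)) := by
  have hcont : ∀ Q : MvPolynomial (Fin 2) ℂ, Continuous fun t : ℝ =>
      MvPolynomial.eval ![Complex.exp (t * Complex.I),
          (starRingEnd ℂ) (Complex.exp (t * Complex.I))] Q := by
    intro Q
    refine (MvPolynomial.continuous_eval Q).comp (continuous_pi fun i => ?_)
    fin_cases i
    · simp only [Fin.zero_eta, Matrix.cons_val_zero]; fun_prop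
    · simp only [Fin.mk_one, Matrix.cons_val_one, Matrix.cons_val_zero]; fun_prop
  induction Q using MvPolynomial.induction_on' with
  | monomial u c =>
    have heval : ∀ z : ℂ, MvPolynomial.eval ![z, (starRingEnd ℂ) z] (MvPolynomial.monomial u c) =
        c * (z ^ u 0 * (starRingEnd ℂ) z ^ u 1) := by
      intro z
      rw [MvPolynomial.eval_monomial, Finsupp.prod_fintype _ _ (by simp), Fin.prod_univ_two]
      simp
    simp only [heval, ← Finset.mul_sum, mul_div_assoc, intervalIntegral.integral_const_mul]
    rw [mul_left_comm, circleAverage_pow_mul_conj_pow]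
    exact (tendsto_average_pow_mul_conj_pow hS hcard hmom hdef _ _).const_mul c
  | add p q hp hq =>
    simp only [map_add, Finset.sum_add_distrib, add_div]
    rw [intervalIntegral.integral_add ((hcont p).intervalIntegrable _ _)
      ((hcont q).intervalIntegrable _ _), mul_add]
    exact hp.add hq

theorem tendsto_average_of_continuous (hS : ∀ n, 1 ≤ n → ∀ z ∈ S n, ‖z‖ ≤ 1)
    (hcard : ∀ n, 1 ≤ n → (S n).card = n)
    (hmom : ∀ m : ℕ, m ≠ 0 → Tendsto (fun n : ℕ => (∑ z ∈ S n, z ^ m) / n) atTop (𝓝 0))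
    (hdef : Tendsto (fun n : ℕ => (∑ z ∈ S n, (1 - ‖z‖ ^ 2)) / (n : ℝ)) atTop (𝓝 0))
    {f : ℂ → ℂ} (hf : Continuous f) :
    Tendsto (fun n : ℕ => (∑ z ∈ S n, f z) / n) atTop
      (𝓝 ((2 * Real.pi : ℂ)⁻¹ * ∫ t in (0 : ℝ)..2 * Real.pi, f (Complex.exp (t * Complex.I)))) := by
  rw [Metric.tendsto_nhds]
  intro ε hε
  obtain ⟨Q, hQ⟩ := exists_mvPolynomial_near f hf (show 0 < ε / 3 by positivity)
  have hlim := Metric.tendsto_nhds.1 (tendsto_average_mvPolynomial hS hcard hmom hdef Q) (ε / 3)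
    (by positivity)
  set g : ℂ → ℂ := fun z => MvPolynomial.eval ![z, (starRingEnd ℂ) z] Q with hg
  have hgc : Continuous g := by
    refine (MvPolynomial.continuous_eval Q).comp (continuous_pi fun i => ?_)
    fin_cases i
    · simp only [Fin.zero_eta, Matrix.cons_val_zero]; fun_prop
    · simp only [Fin.mk_one, Matrix.cons_val_one, Matrix.cons_val_zero]; fun_prop
  have hcirc : dist ((2 * Real.pi : ℂ)⁻¹ *
        ∫ t in (0 : ℝ)..2 * Real.pi, g (Complex.exp (t * Complex.I)))
      ((2 * Real.pi : ℂ)⁻¹ * ∫ t in (0 : ℝ)..2 * Real.pi, f (Complex.exp (t * Complex.I)))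
      ≤ ε / 3 := by
    rw [dist_comm, dist_eq_norm, ← mul_sub, ← intervalIntegral.integral_sub
      (Continuous.intervalIntegrable (by fun_prop) _ _)
      (Continuous.intervalIntegrable (by fun_prop) _ _), norm_mul]
    have h1 := intervalIntegral.norm_integral_le_of_norm_le_const (a := (0 : ℝ))
      (b := 2 * Real.pi) (C := ε / 3)
      (f := fun t : ℝ => f (Complex.exp (t * Complex.I)) - g (Complex.exp (t * Complex.I)))
      fun t _ => (hQ _ (Complex.norm_exp_ofReal_mul_I t).le).le
    have hpi := Real.pi_pos
    have h2 : ‖(2 * Real.pi : ℂ)⁻¹‖ = (2 * Real.pi)⁻¹ := by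
      rw [norm_inv, norm_mul, Complex.norm_real, Real.norm_of_nonneg hpi.le]; simp
    rw [h2, inv_mul_le_iff₀ (by positivity)]
    rw [sub_zero, abs_of_pos (by positivity)] at h1
    linarith
  filter_upwards [hlim, eventually_ge_atTop 1] with n hn hn1
  have hfg : dist ((∑ z ∈ S n, f z) / n) ((∑ z ∈ S n, g z) / n) ≤ ε / 3 := by
    have hn0 : (0 : ℝ) < n := by exact_mod_cast hn1
    rw [dist_eq_norm, ← sub_div, ← Finset.sum_sub_distrib, norm_div, Complex.norm_natCast,
      div_le_iff₀ hn0]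
    refine (norm_sum_le_of_le (S n) fun z hz => (hQ z (hS n hn1 z hz)).le).trans ?_
    rw [Finset.sum_const, hcard n hn1, nsmul_eq_mul, mul_comm]
  have h1 := dist_triangle4 ((∑ z ∈ S n, f z) / n) ((∑ z ∈ S n, g z) / n)
    ((2 * Real.pi : ℂ)⁻¹ * ∫ t in (0 : ℝ)..2 * Real.pi, g (Complex.exp (t * Complex.I)))
    ((2 * Real.pi : ℂ)⁻¹ * ∫ t in (0 : ℝ)..2 * Real.pi, f (Complex.exp (t * Complex.I)))
  linarith

end Equidistribution

/-! ### Energy of the zeros and conclusion. -/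

theorem neg_mul_log_leadingCoeff_le {P : ℤ[X]} (hdeg : 0 < P.natDegree)
    (hnd : (P.aroots ℂ).Nodup) :
    -(((2 * P.natDegree - 1 : ℕ) : ℝ) * Real.log |(P.leadingCoeff : ℝ)|) ≤
      ∑ x ∈ (P.aroots ℂ).toFinset, ∑ y ∈ (P.aroots ℂ).toFinset.erase x, Real.log ‖x - y‖ := by
  have hne : ∀ x ∈ (P.aroots ℂ).toFinset, ∀ y ∈ (P.aroots ℂ).toFinset.erase x, ‖x - y‖ ≠ 0 :=
    fun x _ y hy => norm_ne_zero_iff.2 (sub_ne_zero.2 (Finset.ne_of_mem_erase hy).symm)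
  have h := Real.log_nonneg (one_le_leadingCoeff_pow_mul_prod_dist hdeg hnd)
  have hlc : |(P.leadingCoeff : ℝ)| ≠ 0 := by
    have : P ≠ 0 := by rintro rfl; simp at hdeg
    simpa using this
  rw [Real.log_mul (pow_ne_zero _ hlc)
    (Finset.prod_ne_zero_iff.2 fun x hx => Finset.prod_ne_zero_iff.2 (hne x hx)), Real.log_pow,
    Real.log_prod fun x hx => Finset.prod_ne_zero_iff.2 (hne x hx),
    Finset.sum_congr rfl fun x hx => Real.log_prod (hne x hx)] at h
  linarith

theorem theorem2p3 (P : ℕ → ℤ[X])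
    (hP : ∀ n : ℕ, 1 ≤ n → P n ∈ IntPolySimple n (Metric.closedBall (0 : ℂ) 1))
    (hlim : Tendsto (fun n : ℕ => |((P n).leadingCoeff : ℝ)| ^ (1 / (n : ℝ))) atTop (𝓝 1)) :
    Tendsto (β := FiniteMeasure ℂ) (fun n : ℕ => ⟨zeroCountingMeasure (P n), inferInstance⟩) atTop
        (nhds (X := FiniteMeasure ℂ) ⟨normalizedArclength, inferInstance⟩) ∧
      Tendsto (fun n : ℕ => meanOfZeros (P n)) atTop (𝓝 0) := by
  have hdeg : ∀ n, 1 ≤ n → (P n).natDegree = n := fun n hn =>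
    natDegree_eq_of_degree_eq_some (hP n hn).1
  have hnd : ∀ n, 1 ≤ n → ((P n).aroots ℂ).Nodup := fun n hn => (hP n hn).2.1
  set S : ℕ → Finset ℂ := fun n => ((P n).aroots ℂ).toFinset with hSdef
  have hSv : ∀ n, 1 ≤ n → (S n).val = (P n).aroots ℂ := fun n hn => by
    rw [hSdef, Multiset.toFinset_val, (hnd n hn).dedup]
  have hS : ∀ n, 1 ≤ n → ∀ z ∈ S n, ‖z‖ ≤ 1 := fun n hn z hz => by
    simpa using (hP n hn).2.2 z (Multiset.mem_toFinset.1 hz)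
  have hcard : ∀ n, 1 ≤ n → (S n).card = n := fun n hn => by
    rw [Finset.card_def, hSv n hn, aroots, ← (IsAlgClosed.splits _).natDegree_eq_card_roots,
      natDegree_map_eq_of_injective (algebraMap ℤ ℂ).injective_int, hdeg n hn]
  -- Chosen so that `n² c n = (2n-1) log |aₙ|`; the factor `(2n-1)/n` stays below 2.
  set c : ℕ → ℝ := fun n =>
    ((2 * n - 1 : ℕ) : ℝ) / n * Real.log (|((P n).leadingCoeff : ℝ)| ^ (1 / (n : ℝ))) with hcdef
  have hc : Tendsto c atTop (𝓝 0) := by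
    have hlog : Tendsto (fun n : ℕ => Real.log (|((P n).leadingCoeff : ℝ)| ^ (1 / (n : ℝ)))) atTop
        (𝓝 0) := by
      simpa using hlim.log one_ne_zero
    refine squeeze_zero_norm (fun n => ?_) (by rw [← mul_zero 2, ← norm_zero (E := ℝ)]; exact hlog.norm.const_mul 2)
    rw [hcdef, norm_mul]
    gcongr
    rw [Real.norm_of_nonneg (by positivity)]
    refine div_le_of_le_mul₀ (by positivity) (by norm_num) ?_
    exact_mod_cast Nat.sub_le _ _
  have hE : ∀ n : ℕ, 1 ≤ n →
      -((n : ℝ) ^ 2 * c n) ≤ ∑ x ∈ S n, ∑ y ∈ (S n).erase x, Real.log ‖x - y‖ := by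
    intro n hn
    refine le_of_eq_of_le ?_ (neg_mul_log_leadingCoeff_le (by rw [hdeg n hn]; omega) (hnd n hn))
    have hn0 : (n : ℝ) ≠ 0 := by exact_mod_cast (by omega : n ≠ 0)
    have hpos : 0 < |((P n).leadingCoeff : ℝ)| := by
      have : P n ≠ 0 := by
        intro h0
        have := hdeg n hn
        rw [h0, natDegree_zero] at this
        omega
      simpa using this
    rw [hdeg n hn, hcdef]
    simp only
    rw [Real.log_rpow hpos]
    field_simp
  have hmain := tendsto_moment_add_defect hS hcard hc hE
  have hmom : ∀ m : ℕ, m ≠ 0 → Tendsto (fun n : ℕ => (∑ z ∈ S n, z ^ m) / n) atTop (𝓝 0) := by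
    intro m hm
    rw [tendsto_zero_iff_norm_tendsto_zero]
    refine tendsto_zero_of_sq_le_mul m (hmain m) fun n => ?_
    have hm0 : (m : ℝ) ≠ 0 := by exact_mod_cast hm
    rw [mul_add, mul_div_cancel₀ _ hm0]
    exact le_add_of_nonneg_right (by positivity)
  have hdef : Tendsto (fun n : ℕ => (∑ z ∈ S n, (1 - ‖z‖ ^ 2)) / (n : ℝ)) atTop (𝓝 0) := by
    -- At `m = 0` the moment term is divided by zero, hence is 0, and only the defect remains.
    refine tendsto_zero_of_sq_le_mul 8 (hmain 0) fun n => ?_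
    simp only [Nat.cast_zero, div_zero, zero_add]
    linarith
  refine ⟨?_, ?_⟩
  · refine (FiniteMeasure.tendsto_iff_forall_integral_rclike_tendsto ℂ).2 fun f => ?_
    have h := tendsto_average_of_continuous hS hcard hmom hdef f.continuous
    rw [← integral_normalizedArclength f.continuous] at h
    refine h.congr' ?_
    filter_upwards [eventually_ge_atTop 1] with n hn
    have := integral_zeroCountingMeasure (hnd n hn) f
    rw [hdeg n hn] at this
    exact this.symm
  · refine (hmom 1 one_ne_zero).congr' ?_
    filter_upwards [eventually_ge_atTop 1] with n hn
    rw [meanOfZeros, hdeg n hn, ← hSv n hn, Finset.sum_val]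
    simp
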